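/- Let $R$ be a commutative ring with an ideal $\mathfrak m$ such that $\mathfrak m^2=\mathfrak m$. An $R$-module $Z$ is almost zero if $\mathfrak m Z=0$. The almost $R$-modules are the objects of the quotient $\mathrm{Mod}^a_R$ of the category of $R$-modules by the Serre subcategory of almost zero modules, and $M\mapsto M^a$ denotes the quotient functor. An $R$-module $M$ is * almost flat if the functor $M^a\otimes_{R^a}-$, induced on $\mathrm{Mod}^a_R$ by $M\otimes_R-$, is exact; equivalently, if $M\otimes_R-$ sends every sequence $A\to B\to C$ of $R$-modules that becomes exact in $\mathrm{Mod}^a_R$ to a sequence that becomes exact in $\mathrm{Mod}^a_R$; * almost finitely generated if for every $s\in\mathfrak m$ there are $n\ge 0$ and an $R$-linear map $R^n\to M$ whose cokernel is killed by $s$; * almost finitely presented if for all $s,t\in\mathfrak m$ there is a complex $R^m\xrightarrow{g}R^n\xrightarrow{f}M$ with $s\,\mathrm{Coker}(f)=0$ and $t\,\mathrm{Ker}(f)\subseteq\mathrm{Im}(g)$; * almost coherent if it is almost finitely generated and every $R$-module $N$ that is almost finitely generated and satisfies $N^a\subseteq M^a$ (that is, admits an $R$-linear map $N\to M$ with almost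 zero kernel) is almost finitely presented. The ring $R$ is almost coherent if it is almost coherent as an $R$-module. An almost flat preenvelope of an $R$-module $M$ is an $R$-linear map $f\colon M\to P$ with $P$ almost flat such that for every almost flat $R$-module $P'$ the map $\mathrm{Hom}_R(P,P')\to\mathrm{Hom}_R(M,P')$, $h\mapsto h\circ f$, is surjective. Theorem. The following assertions are equivalent. 1. $R$ is an almost coherent ring. 2. Any product of almost flat $R$-modules is almost flat. 3. Any product of flat $R$-modules is almost flat. 4. Any product of projective $R$-modules is almost flat. 5. Any product of copies of $R$ is almost flat. 6. Any $R$-module has an almost flat preenvelope. -/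

import Mathlib

open scoped TensorProduct

universe u

/-! Almost mathematics over a commutative ring `R` with respect to an ideal `𝔪`.  The category of
almost modules is the quotient of `R`-modules by the Serre subcategory of almost zero modules.
The functor from modules to almost modules is exact and essentially surjective, and every
three-term exact sequence of almost modules comes, up to isomorphism, from a sequence of
`R`-modules; so exactness of almost modules is expressed below through modules. -/

section AlmostMath

variable {R : Type u} [CommRing R] (𝔪 : Ideal R)

/-- `M` is almost zero: `𝔪 M = 0`. -/
def IsAlmostZero (M : Type u) [AddCommGroup M] [Module R M] : Prop :=
  ∀ s ∈ 𝔪, ∀ x : M, s • x = 0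

/-- `f` becomes injective in almost modules: its kernel is almost zero. -/
def IsAlmostInjective {M N : Type u} [AddCommGroup M] [Module R M] [AddCommGroup N] [Module R N]
    (f : M →ₗ[R] N) : Prop :=
  IsAlmostZero 𝔪 (LinearMap.ker f)

/-- `A → B → C` becomes exact (at the middle term) in almost modules: the composite `g ∘ f` is zero
there, i.e. has almost zero image, and the almost submodules given by `ker g` and `range f` agree,
i.e. `𝔪 (ker g) ⊆ range f`. -/
def IsAlmostExact {A B C : Type u} [AddCommGroup A] [Module R A] [AddCommGroup B] [Module R B]
    [AddCommGroup C] [Module R C] (f : A →ₗ[R] B) (g : B →ₗ[R] C) : Prop :=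
  IsAlmostZero 𝔪 (LinearMap.range (g ∘ₗ f)) ∧
    ∀ s ∈ 𝔪, ∀ b ∈ LinearMap.ker g, s • b ∈ LinearMap.range f

/-- `M` is almost flat: tensoring with `M` is an exact functor on almost modules, that is, it
preserves almost exactness of sequences `A → B → C`. -/
def IsAlmostFlat (M : Type u) [AddCommGroup M] [Module R M] : Prop :=
  ∀ (A B C : Type u) [AddCommGroup A] [Module R A] [AddCommGroup B] [Module R B]
    [AddCommGroup C] [Module R C] (f : A →ₗ[R] B) (g : B →ₗ[R] C),
    IsAlmostExact 𝔪 f g → IsAlmostExact 𝔪 (f.lTensor M) (g.lTensor M)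

/-- `M` is almost finitely generated: for each `s ∈ 𝔪` there is `f : Rⁿ → M` whose cokernel is
killed by `s`. -/
def IsAlmostFG (M : Type u) [AddCommGroup M] [Module R M] : Prop :=
  ∀ s ∈ 𝔪, ∃ (n : ℕ) (f : (Fin n → R) →ₗ[R] M), ∀ x : M, s • x ∈ LinearMap.range f

/-- `M` is almost finitely presented: for all `s, t ∈ 𝔪` there is a complex `Rᵐ → Rⁿ → M` with
maps `g`, `f` such that `s` kills the cokernel of `f` and `t (ker f) ⊆ range g`. -/
def IsAlmostFP (M : Type u) [AddCommGroup M] [Module R M] : Prop :=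
  ∀ s ∈ 𝔪, ∀ t ∈ 𝔪, ∃ (m n : ℕ) (g : (Fin m → R) →ₗ[R] (Fin n → R)) (f : (Fin n → R) →ₗ[R] M),
    f ∘ₗ g = 0 ∧ (∀ x : M, s • x ∈ LinearMap.range f) ∧
      ∀ y ∈ LinearMap.ker f, t • y ∈ LinearMap.range g

/-- `M` is almost coherent: it is almost finitely generated, and every almost finitely generated
almost submodule of `M` is almost finitely presented.  An almost submodule of `M` is represented by
an almost injective linear map `N → M`; actual submodules are a special case. -/
def IsAlmostCoherent (M : Type u) [AddCommGroup M] [Module R M] : Prop :=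
  IsAlmostFG 𝔪 M ∧
    ∀ (N : Type u) [AddCommGroup N] [Module R N] (i : N →ₗ[R] M),
      IsAlmostInjective 𝔪 i → IsAlmostFG 𝔪 N → IsAlmostFP 𝔪 N

/-- The ring `R` is almost coherent if it is so as a module over itself. -/
def IsAlmostCoherentRing : Prop := IsAlmostCoherent 𝔪 R

/-- `f : M → P` is an almost flat preenvelope: `P` is almost flat, and every linear map from `M` to
an almost flat module factors (not necessarily uniquely) through `f`. -/
def IsAlmostFlatPreenvelope {M P : Type u} [AddCommGroup M] [Module R M]
    [AddCommGroup P] [Module R P] (f : M →ₗ[R] P) : Prop :=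
  IsAlmostFlat 𝔪 P ∧
    ∀ (Q : Type u) [AddCommGroup Q] [Module R Q], IsAlmostFlat 𝔪 Q →
      Function.Surjective (fun h : P →ₗ[R] Q => h ∘ₗ f)

end AlmostMath

/-!
Everything rests on `𝔪 = 𝔪²`: finitely many steps, each losing a factor from `𝔪`, lose no more
than one such factor altogether. So the usual dévissage of relative flatness through
submodules, quotients and finite products survives, and almost flatness can be tested on
finitely generated ideals.

If `N` is almost finitely presented and the `Fᵢ` are almost flat, then
`(∏ Fᵢ) ⊗ N → ∏ (Fᵢ ⊗ N)` is almost injective, by comparison with a presentation of `N`, since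
the map is bijective for finite free modules. Applied to finitely generated ideals `N`,
this gives almost flat products over an almost coherent ring. Conversely, let `q : Rⁿ → R` have
kernel `K`. The tautological family `(k)_{k ∈ K}` is an element of `Rᴷ ⊗ Rⁿ` killed by `q`;
when `Rᴷ` is almost flat, a multiple of it by `s ∈ 𝔪` comes from `Rᴷ ⊗ K`, and the finitely
many elements of `K` that occur there generate a submodule containing `s K`.

For preenvelopes, a map from `M` to an almost flat module `Q` lands in a pure submodule whose
cardinality is bounded in terms of `R` and `M`, and pure submodules of `Q` are almost flat.
Hence there is a set of test modules, and the product of all maps from `M` into them is a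
preenvelope as soon as products of almost flat modules are almost flat. Conversely, a product
of almost flat modules is a retract of its preenvelope.
-/

section Idempotent

variable {R M : Type*} [CommRing R] {𝔪 : Ideal R} [AddCommGroup M] [Module R M]

theorem smul_mem_of_forall_smul_smul_mem (h𝔪 : 𝔪 ^ 2 = 𝔪) {N : Submodule R M} {x : M}
    (h : ∀ s ∈ 𝔪, ∀ t ∈ 𝔪, s • t • x ∈ N) : ∀ s ∈ 𝔪, s • x ∈ N := by
  suffices 𝔪 ≤ N.comap (LinearMap.toSpanSingleton R M x) from this
  rw [← h𝔪, pow_two, Ideal.mul_le]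
  intro s hs t ht
  simpa [mul_smul] using h s hs t ht

theorem smul_eq_zero_of_forall_smul_smul_eq_zero (h𝔪 : 𝔪 ^ 2 = 𝔪) {x : M}
    (h : ∀ s ∈ 𝔪, ∀ t ∈ 𝔪, s • t • x = 0) : ∀ s ∈ 𝔪, s • x = 0 :=
  smul_mem_of_forall_smul_smul_mem (N := ⊥) h𝔪 h

end Idempotent

section Tensor

variable {R : Type*} [CommRing R] (M : Type*) [AddCommGroup M] [Module R M]
  {A B C : Type*} [AddCommGroup A] [Module R A] [AddCommGroup B] [Module R B]
  [AddCommGroup C] [Module R C]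

theorem smul_lTensor_mem_range_lTensor {s : R} {f : A →ₗ[R] B} {g : C →ₗ[R] B}
    (h : ∀ c, s • g c ∈ LinearMap.range f) (z : M ⊗[R] C) :
    s • g.lTensor M z ∈ LinearMap.range (f.lTensor M) := by
  induction z with
  | zero => simp
  | tmul m c =>
    obtain ⟨a, ha⟩ := h c
    exact ⟨m ⊗ₜ a, by simp [ha]⟩
  | add x y hx hy =>
    rw [map_add, smul_add]
    exact add_mem hx hy

theorem lTensor_rTensor_comm {N : Type*} [AddCommGroup N] [Module R N] (f : A →ₗ[R] B)
    (φ : M →ₗ[R] N) (z : M ⊗[R] A) :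
    f.lTensor N (φ.rTensor A z) = φ.rTensor B (f.lTensor M z) := by
  rw [← LinearMap.comp_apply, LinearMap.lTensor_comp_rTensor, ← LinearMap.rTensor_comp_lTensor,
    LinearMap.comp_apply]

theorem lid_lTensor (f : A →ₗ[R] B) (z : R ⊗[R] A) :
    TensorProduct.lid R B (f.lTensor R z) = f (TensorProduct.lid R A z) :=
  LinearMap.congr_fun (f := (TensorProduct.lid R B).toLinearMap ∘ₗ f.lTensor R)
    (g := f ∘ₗ (TensorProduct.lid R A).toLinearMap) (by ext; simp) z

theorem exists_sum_tmul_eq_of_span_eq_top {κ : Type*} [Fintype κ] {a : κ → A}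
    (ha : Submodule.span R (Set.range a) = ⊤) (z : M ⊗[R] A) :
    ∃ q : κ → M, z = ∑ k, q k ⊗ₜ[R] a k := by
  induction z with
  | zero => exact ⟨0, by simp⟩
  | tmul m x =>
    have hx : x ∈ Submodule.span R (Set.range a) := ha ▸ Submodule.mem_top
    obtain ⟨c, rfl⟩ := (Submodule.mem_span_range_iff_exists_fun R).1 hx
    exact ⟨fun k => c k • m, by simp [TensorProduct.tmul_sum, TensorProduct.smul_tmul]⟩
  | add x y hx hy =>
    obtain ⟨q, rfl⟩ := hx
    obtain ⟨q', rfl⟩ := hy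
    exact ⟨q + q', by simp [TensorProduct.add_tmul, Finset.sum_add_distrib]⟩

theorem exists_fg_inclusion_lTensor_eq_zero {N : Submodule R A} (hN : N.FG) {x : M ⊗[R] N}
    (hx : N.subtype.lTensor M x = 0) :
    ∃ N' : Submodule R A, N'.FG ∧ ∃ h : N ≤ N', (Submodule.inclusion h).lTensor M x = 0 := by
  have hx' : N.subtype.rTensor M (TensorProduct.comm R M N x) = N.subtype.rTensor M 0 := by
    rw [LinearMap.rTensor_comm, hx, map_zero, map_zero]
  obtain ⟨N', hN', le, h⟩ := hN.exists_rTensor_fg_inclusion_eq hx'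
  refine ⟨N', hN', le, (TensorProduct.comm R M N').injective ?_⟩
  rwa [map_zero, ← LinearMap.rTensor_comm, ← map_zero ((Submodule.inclusion le).rTensor M)]

end Tensor

section AlmostFlat

variable {R : Type u} [CommRing R] {𝔪 : Ideal R} {M P A B C : Type u}
  [AddCommGroup M] [Module R M] [AddCommGroup P] [Module R P]
  [AddCommGroup A] [Module R A] [AddCommGroup B] [Module R B] [AddCommGroup C] [Module R C]

theorem isAlmostInjective_iff {f : A →ₗ[R] B} :
    IsAlmostInjective 𝔪 f ↔ ∀ x, f x = 0 → ∀ s ∈ 𝔪, s • x = 0 :=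
  ⟨fun h x hx s hs => congrArg Subtype.val (h s hs ⟨x, hx⟩),
    fun h s hs x => Subtype.ext (h x.1 x.2 s hs)⟩

theorem IsAlmostInjective.of_injective {f : A →ₗ[R] B} (hf : Function.Injective f) :
    IsAlmostInjective 𝔪 f :=
  isAlmostInjective_iff.2 fun x hx s _ => by rw [(map_eq_zero_iff f hf).1 hx, smul_zero]

theorem IsAlmostExact.of_exact {f : A →ₗ[R] B} {g : B →ₗ[R] C} (h : Function.Exact f g) :
    IsAlmostExact 𝔪 f g := by
  refine ⟨?_, fun s _ b hb => Submodule.smul_mem _ s ((h b).1 hb)⟩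
  rw [h.linearMap_comp_eq_zero, LinearMap.range_zero]
  exact fun s _ x => Subsingleton.elim _ _

theorem IsAlmostZero.range_lTensor_comp {f : A →ₗ[R] B} {g : B →ₗ[R] C}
    (h : IsAlmostZero 𝔪 (LinearMap.range (g ∘ₗ f))) :
    IsAlmostZero 𝔪 (LinearMap.range (g.lTensor M ∘ₗ f.lTensor M)) := by
  rintro s hs ⟨_, y, rfl⟩
  have hsgf : s • (g ∘ₗ f) = 0 :=
    LinearMap.ext fun a => congrArg Subtype.val (h s hs ⟨_, a, rfl⟩)
  refine Subtype.ext ?_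
  change s • (g.lTensor M ∘ₗ f.lTensor M) y = 0
  rw [← LinearMap.lTensor_comp, ← LinearMap.smul_apply, ← LinearMap.lTensor_smul, hsgf,
    LinearMap.lTensor_zero, LinearMap.zero_apply]

theorem IsAlmostFlat.smul_mem_range_lTensor (hM : IsAlmostFlat 𝔪 M) {f : A →ₗ[R] B}
    {g : B →ₗ[R] C} (hfg : Function.Exact f g) {z : M ⊗[R] B} (hz : g.lTensor M z = 0) {s : R}
    (hs : s ∈ 𝔪) : s • z ∈ LinearMap.range (f.lTensor M) :=
  (hM A B C f g (IsAlmostExact.of_exact hfg)).2 s hs z hz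

theorem IsAlmostFlat.isAlmostInjective_lTensor (hM : IsAlmostFlat 𝔪 M) {f : A →ₗ[R] B}
    (hf : Function.Injective f) : IsAlmostInjective 𝔪 (f.lTensor M) := by
  refine isAlmostInjective_iff.2 fun x hx s hs => ?_
  have hex : Function.Exact (0 : A →ₗ[R] A) f := (f.exact_zero_iff_injective A).2 hf
  simpa using hM.smul_mem_range_lTensor hex hx hs

theorem IsAlmostFlat.of_flat [Module.Flat R M] : IsAlmostFlat 𝔪 M := by
  rintro A B C _ _ _ _ _ _ f g ⟨hgf, hker⟩
  refine ⟨hgf.range_lTensor_comp, fun s hs b hb => ?_⟩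
  obtain ⟨z, rfl⟩ := (Module.Flat.lTensor_exact M g.exact_subtype_ker_map b).1 hb
  exact smul_lTensor_mem_range_lTensor M (fun k : g.ker => hker s hs k k.2) z

theorem IsAlmostFlat.of_retract (hP : IsAlmostFlat 𝔪 P) (i : M →ₗ[R] P) (r : P →ₗ[R] M)
    (h : r ∘ₗ i = LinearMap.id) : IsAlmostFlat 𝔪 M := by
  rintro A B C _ _ _ _ _ _ f g hfg
  refine ⟨hfg.1.range_lTensor_comp, fun s hs b hb => ?_⟩
  have hib : g.lTensor P (i.rTensor B b) = 0 := by
    rw [lTensor_rTensor_comm, LinearMap.mem_ker.1 hb, map_zero]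
  obtain ⟨y, hy⟩ := (hP A B C f g hfg).2 s hs _ hib
  refine ⟨r.rTensor A y, ?_⟩
  rw [lTensor_rTensor_comm, hy, map_smul, ← LinearMap.rTensor_comp_apply, h, LinearMap.rTensor_id,
    LinearMap.id_apply]

variable (𝔪 M P) in
/-- `M` is almost flat relative to `P`: tensoring with `M` sends every injection into `P` to an
almost injective map.  This is the almost analogue of the classical relative flatness ("`M` is
`P`-flat"); for fixed `M`, the class of such `P` is studied by dévissage. -/
def IsAlmostFlatRelTo : Prop :=
  ∀ (N : Type u) [AddCommGroup N] [Module R N] (f : N →ₗ[R] P),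
    Function.Injective f → IsAlmostInjective 𝔪 (f.lTensor M)

theorem IsAlmostFlatRelTo.smul_mem_range_lTensor_ker (h : IsAlmostFlatRelTo 𝔪 M B) {g : A →ₗ[R] B}
    {z : M ⊗[R] A} (hz : g.lTensor M z = 0) {s : R} (hs : s ∈ 𝔪) :
    s • z ∈ LinearMap.range (g.ker.subtype.lTensor M) := by
  have hex : Function.Exact g.ker.subtype g.rangeRestrict := by
    rw [LinearMap.exact_iff, LinearMap.ker_rangeRestrict, Submodule.range_subtype]
  refine (lTensor_exact M hex g.surjective_rangeRestrict _).1 ?_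
  rw [map_smul]
  refine isAlmostInjective_iff.1 (h _ _ g.range.injective_subtype) _ ?_ s hs
  rw [← LinearMap.lTensor_comp_apply]
  exact hz

theorem IsAlmostFlat.of_forall_isAlmostFlatRelTo (h𝔪 : 𝔪 ^ 2 = 𝔪)
    (h : ∀ (P : Type u) [AddCommGroup P] [Module R P], IsAlmostFlatRelTo 𝔪 M P) :
    IsAlmostFlat 𝔪 M := by
  rintro A B C _ _ _ _ _ _ f g ⟨hgf, hker⟩
  refine ⟨hgf.range_lTensor_comp, fun r hr b hb => ?_⟩
  refine smul_mem_of_forall_smul_smul_mem h𝔪 (fun s hs t ht => ?_) r hr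
  obtain ⟨z, hz⟩ := (h C).smul_mem_range_lTensor_ker hb ht
  rw [← hz]
  exact smul_lTensor_mem_range_lTensor M (fun k : g.ker => hker s hs k k.2) z

theorem IsAlmostFlatRelTo.of_surjective (h : IsAlmostFlatRelTo 𝔪 M P) {p : P →ₗ[R] B}
    (hp : Function.Surjective p) : IsAlmostFlatRelTo 𝔪 M B := by
  intro N _ _ f hf
  refine isAlmostInjective_iff.2 fun x hx s hs => ?_
  let q : N × P →ₗ[R] B := f.coprod p
  let W := LinearMap.ker q
  let a : W →ₗ[R] N := LinearMap.fst R N P ∘ₗ W.subtype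
  let b : W →ₗ[R] P := LinearMap.snd R N P ∘ₗ W.subtype
  have hq : Function.Surjective q := fun y => (hp y).imp' (Prod.mk 0) (by simp [q])
  have hb : Function.Injective b := by
    refine (injective_iff_map_eq_zero b).2 fun ⟨⟨n, y⟩, hw⟩ hy => ?_
    obtain rfl : y = 0 := hy
    obtain rfl : n = 0 := hf (by simpa [W, q] using hw)
    rfl
  have hqx : q.lTensor M ((LinearMap.inl R N P).lTensor M x) = 0 := by
    rw [← LinearMap.lTensor_comp_apply, LinearMap.coprod_inl, hx]
  obtain ⟨z, hz⟩ := (lTensor_exact M q.exact_subtype_ker_map hq _).1 hqx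
  have haz : a.lTensor M z = x := by
    rw [LinearMap.lTensor_comp_apply, hz, ← LinearMap.lTensor_comp_apply, LinearMap.fst_comp_inl,
      LinearMap.lTensor_id, LinearMap.id_apply]
  have hbz : b.lTensor M z = 0 := by
    rw [LinearMap.lTensor_comp_apply, hz, ← LinearMap.lTensor_comp_apply, LinearMap.snd_comp_inl,
      LinearMap.lTensor_zero, LinearMap.zero_apply]
  rw [← haz, ← map_smul, isAlmostInjective_iff.1 (h W b hb) z hbz s hs, map_zero]

theorem IsAlmostFlatRelTo.prod (h𝔪 : 𝔪 ^ 2 = 𝔪) (hA : IsAlmostFlatRelTo 𝔪 M A)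
    (hB : IsAlmostFlatRelTo 𝔪 M B) : IsAlmostFlatRelTo 𝔪 M (A × B) := by
  intro N _ _ f hf
  refine isAlmostInjective_iff.2 fun x hx => smul_eq_zero_of_forall_smul_smul_eq_zero h𝔪
    fun s hs t ht => ?_
  let p : N →ₗ[R] B := LinearMap.snd R A B ∘ₗ f
  let q : p.ker →ₗ[R] A := LinearMap.fst R A B ∘ₗ f ∘ₗ p.ker.subtype
  have hq : Function.Injective q := by
    refine (injective_iff_map_eq_zero q).2 fun ⟨y, hy⟩ hqy => Subtype.ext (hf ?_)
    have hfy : f y = 0 := Prod.ext hqy hy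
    rw [hfy, ZeroMemClass.coe_zero, map_zero]
  have hpx : p.lTensor M x = 0 := by rw [LinearMap.lTensor_comp_apply, hx, map_zero]
  obtain ⟨z, hz⟩ := hB.smul_mem_range_lTensor_ker hpx ht
  have hqz : q.lTensor M z = 0 := by
    rw [LinearMap.lTensor_comp_apply, LinearMap.lTensor_comp_apply, hz, map_smul, hx, smul_zero,
      map_zero]
  rw [← hz, ← map_smul, isAlmostInjective_iff.1 (hA _ q hq) z hqz s hs, map_zero]

theorem IsAlmostFlatRelTo.of_finite (h𝔪 : 𝔪 ^ 2 = 𝔪) (h : IsAlmostFlatRelTo 𝔪 M R)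
    [Module.Finite R P] : IsAlmostFlatRelTo 𝔪 M P := by
  obtain ⟨n, p, hp⟩ := Module.Finite.exists_fin' R P
  suffices IsAlmostFlatRelTo 𝔪 M (Fin n → R) from this.of_surjective hp
  refine Module.pi_induction' R (fun N => IsAlmostFlatRelTo 𝔪 M N)
    (fun N => IsAlmostFlatRelTo 𝔪 M N) (fun e h => h.of_surjective e.surjective)
    (fun e h => h.of_surjective e.surjective) ?_ (.prod h𝔪) _ fun _ => h
  exact h.of_surjective (p := 0) fun x => ⟨0, Subsingleton.elim _ _⟩

theorem isAlmostInjective_lTensor_of_forall_fg {f : A →ₗ[R] B}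
    (h : ∀ N : Submodule R A, N.FG → IsAlmostInjective 𝔪 ((f ∘ₗ N.subtype).lTensor M)) :
    IsAlmostInjective 𝔪 (f.lTensor M) := by
  refine isAlmostInjective_iff.2 fun x hx s hs => ?_
  obtain ⟨N, hN, hxN⟩ :=
    TensorProduct.exists_finite_submodule_right_of_setFinite {x} (Set.finite_singleton x)
  obtain ⟨y, rfl⟩ := hxN rfl
  have hy : (f ∘ₗ N.subtype).lTensor M y = 0 := by rw [LinearMap.lTensor_comp_apply, hx]
  rw [← map_smul, isAlmostInjective_iff.1 (h N (Module.Finite.iff_fg.1 hN)) y hy s hs, map_zero]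

theorem IsAlmostFlatRelTo.of_forall_fg
    (h : ∀ P' : Submodule R P, P'.FG → IsAlmostFlatRelTo 𝔪 M P') : IsAlmostFlatRelTo 𝔪 M P := by
  intro N _ _ f hf
  refine isAlmostInjective_lTensor_of_forall_fg fun N' hN' => ?_
  refine isAlmostInjective_iff.2 fun x hx s hs => ?_
  let e : N' ≃ₗ[R] N'.map f := N'.equivMapOfInjective f hf
  have hex : (N'.map f).subtype.lTensor M (e.toLinearMap.lTensor M x) = 0 := by
    rw [← LinearMap.lTensor_comp_apply]
    exact hx
  obtain ⟨P', hP', le, hx'⟩ := exists_fg_inclusion_lTensor_eq_zero M (hN'.map f) hex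
  rw [← LinearMap.lTensor_comp_apply] at hx'
  have hinj : Function.Injective (Submodule.inclusion le ∘ₗ e.toLinearMap) :=
    (Submodule.inclusion_injective le).comp e.injective
  exact isAlmostInjective_iff.1 (h P' hP' _ _ hinj) x hx' s hs

theorem isAlmostInjective_lTensor_of_range_subtype {f : A →ₗ[R] B} (hf : Function.Injective f)
    (h : IsAlmostInjective 𝔪 (f.range.subtype.lTensor M)) :
    IsAlmostInjective 𝔪 (f.lTensor M) := by
  refine isAlmostInjective_iff.2 fun x hx s hs => ?_
  let e : A ≃ₗ[R] f.range := LinearEquiv.ofInjective f hf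
  apply (e.lTensor M).injective
  rw [map_smul, map_zero]
  refine isAlmostInjective_iff.1 h _ ?_ s hs
  rw [← hx]
  exact (LinearMap.lTensor_comp_apply M f.range.subtype e.toLinearMap x).symm

theorem IsAlmostFlat.of_forall_fg_ideal (h𝔪 : 𝔪 ^ 2 = 𝔪)
    (h : ∀ I : Ideal R, I.FG → IsAlmostInjective 𝔪 (I.subtype.lTensor M)) : IsAlmostFlat 𝔪 M := by
  have hR : IsAlmostFlatRelTo 𝔪 M R := by
    refine fun N _ _ j hj => isAlmostInjective_lTensor_of_forall_fg fun N' hN' => ?_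
    refine isAlmostInjective_lTensor_of_range_subtype (hj.comp N'.injective_subtype) (h _ ?_)
    rw [LinearMap.range_comp, Submodule.range_subtype]
    exact hN'.map j
  refine .of_forall_isAlmostFlatRelTo h𝔪 fun P _ _ => .of_forall_fg fun P' hP' => ?_
  have := Module.Finite.iff_fg.2 hP'
  exact hR.of_finite h𝔪

theorem IsAlmostFlat.of_rTensor_injective (h𝔪 : 𝔪 ^ 2 = 𝔪) (hP : IsAlmostFlat 𝔪 P)
    (i : M →ₗ[R] P) (hi : ∀ I : Ideal R, I.FG → Function.Injective (i.rTensor I)) :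
    IsAlmostFlat 𝔪 M := by
  refine .of_forall_fg_ideal h𝔪 fun I hI => isAlmostInjective_iff.2 fun x hx s hs => ?_
  apply hi I hI
  rw [map_smul, map_zero]
  refine isAlmostInjective_iff.1 (hP.isAlmostInjective_lTensor I.injective_subtype) _ ?_ s hs
  rw [lTensor_rTensor_comm, hx, map_zero]

end AlmostFlat

section PiTensor

variable (R : Type*) [CommRing R] {ι : Type*} (F : ι → Type*) [∀ i, AddCommGroup (F i)]
  [∀ i, Module R (F i)] (X : Type*) {Y : Type*} [AddCommGroup X] [Module R X] [AddCommGroup Y]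
  [Module R Y]

/-- The canonical map `(∏ᵢ Fᵢ) ⊗ X → ∏ᵢ (Fᵢ ⊗ X)`, for an arbitrary index type.  It is the
counterpart of `TensorProduct.piRightHom` with the product in the left factor. -/
noncomputable def piTensorHom : (∀ i, F i) ⊗[R] X →ₗ[R] ∀ i, F i ⊗[R] X :=
  LinearMap.pi fun i => (LinearMap.proj i).rTensor X

variable {R F X}

@[simp]
theorem piTensorHom_tmul (p : ∀ i, F i) (x : X) : piTensorHom R F X (p ⊗ₜ x) = fun i => p i ⊗ₜ x :=
  rfl

theorem piTensorHom_apply (z : (∀ i, F i) ⊗[R] X) (i : ι) :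
    piTensorHom R F X z i = (LinearMap.proj i : (∀ i, F i) →ₗ[R] F i).rTensor X z :=
  rfl

theorem piTensorHom_lTensor (g : X →ₗ[R] Y) (z : (∀ i, F i) ⊗[R] X) (i : ι) :
    piTensorHom R F Y (g.lTensor _ z) i = g.lTensor (F i) (piTensorHom R F X z i) := by
  rw [piTensorHom_apply, piTensorHom_apply, lTensor_rTensor_comm]

theorem piScalarRightHom_piTensorHom {κ : Type*} (z : (∀ i, F i) ⊗[R] (κ → R)) (i : ι) (k : κ) :
    TensorProduct.piScalarRightHom R R (F i) κ (piTensorHom R F _ z i) k =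
      TensorProduct.piScalarRightHom R R (∀ i, F i) κ z k i := by
  induction z with
  | zero => simp
  | tmul p x => simp
  | add x y hx hy => simp only [map_add, Pi.add_apply, hx, hy]

theorem piTensorHom_pi_bijective (κ : Type*) [Finite κ] :
    Function.Bijective (piTensorHom R F (κ → R)) := by
  classical
  cases nonempty_fintype κ
  constructor
  · refine (injective_iff_map_eq_zero _).2 fun z hz => ?_
    apply (TensorProduct.piScalarRight R R (∀ i, F i) κ).injective
    ext k i
    simp [← piScalarRightHom_piTensorHom, hz]
  · intro y
    let e (i : ι) := TensorProduct.piScalarRight R R (F i) κ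
    refine ⟨(TensorProduct.piScalarRight R R (∀ i, F i) κ).symm fun k i => e i (y i) k,
      funext fun i => (e i).injective (funext fun k => ?_)⟩
    simp only [e, TensorProduct.piScalarRight_apply, piScalarRightHom_piTensorHom]
    rw [← TensorProduct.piScalarRight_apply, LinearEquiv.apply_symm_apply]

variable (R F X) in
theorem piTensorHom_bijective [Module.Free R X] [Module.Finite R X] :
    Function.Bijective (piTensorHom R F X) := by
  let e := (Module.Free.chooseBasis R X).equivFun
  have h : piTensorHom R F X = (LinearEquiv.piCongrRight fun i => e.symm.lTensor (F i)) ∘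
      piTensorHom R F _ ∘ e.lTensor (∀ i, F i) := by
    refine funext fun z => funext fun i => ?_
    refine ((e.lTensor (F i)).symm_apply_eq.2 ?_).symm
    exact piTensorHom_lTensor e.toLinearMap z i
  rw [h]
  exact (LinearEquiv.bijective _).comp
    ((piTensorHom_pi_bijective _).comp (LinearEquiv.bijective _))

theorem lTensor_eq_zero_iff_piTensorHom [Module.Free R Y] [Module.Finite R Y] {g : X →ₗ[R] Y}
    {z : (∀ i, F i) ⊗[R] X} :
    g.lTensor _ z = 0 ↔ ∀ i, g.lTensor (F i) (piTensorHom R F X z i) = 0 := by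
  simp only [← piTensorHom_lTensor, ← map_eq_zero_iff _ (piTensorHom_bijective R F Y).injective,
    funext_iff, Pi.zero_apply]

theorem mem_range_lTensor_iff_piTensorHom [Module.Free R X] [Module.Finite R X] [Module.Free R Y]
    [Module.Finite R Y] {g : X →ₗ[R] Y} {z : (∀ i, F i) ⊗[R] Y} :
    z ∈ LinearMap.range (g.lTensor _) ↔
      ∀ i, piTensorHom R F Y z i ∈ LinearMap.range (g.lTensor (F i)) := by
  constructor
  · rintro ⟨y, rfl⟩ i
    exact ⟨_, (piTensorHom_lTensor g y i).symm⟩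
  · intro h
    choose v hv using h
    obtain ⟨y, hy⟩ := (piTensorHom_bijective R F X).surjective v
    refine ⟨y, (piTensorHom_bijective R F Y).injective (funext fun i => ?_)⟩
    rw [piTensorHom_lTensor, hy, hv]

end PiTensor

section Coherent

variable {R : Type u} [CommRing R] {𝔪 : Ideal R} {N : Type u} [AddCommGroup N] [Module R N]

theorem IsAlmostFP.isAlmostInjective_piTensorHom (h𝔪 : 𝔪 ^ 2 = 𝔪) (hN : IsAlmostFP 𝔪 N)
    {ι : Type u} {F : ι → Type u} [∀ i, AddCommGroup (F i)] [∀ i, Module R (F i)]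
    (hF : ∀ i, IsAlmostFlat 𝔪 (F i)) : IsAlmostInjective 𝔪 (piTensorHom R F N) := by
  refine isAlmostInjective_iff.2 fun z hz => ?_
  refine smul_eq_zero_of_forall_smul_smul_eq_zero h𝔪 fun r hr s hs => ?_
  refine smul_eq_zero_of_forall_smul_smul_eq_zero h𝔪 (fun t ht u hu => ?_) r hr
  obtain ⟨m, n, g, f, hfg, hs, ht⟩ := hN s hs t ht
  obtain ⟨w, hw⟩ := smul_lTensor_mem_range_lTensor (∀ i, F i) (g := LinearMap.id) hs z
  rw [LinearMap.lTensor_id, LinearMap.id_apply] at hw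
  have hw_mem (i : ι) : t • u • piTensorHom R F _ w i ∈ LinearMap.range (g.lTensor (F i)) := by
    have hwi : f.lTensor (F i) (piTensorHom R F _ w i) = 0 := by
      rw [← piTensorHom_lTensor, hw, map_smul, hz, smul_zero, Pi.zero_apply]
    obtain ⟨y, hy⟩ := (hF i).smul_mem_range_lTensor f.exact_subtype_ker_map hwi hu
    rw [← hy]
    exact smul_lTensor_mem_range_lTensor (F i) (fun k : f.ker => ht k k.2) y
  obtain ⟨v, hv⟩ : t • u • w ∈ LinearMap.range (g.lTensor (∀ i, F i)) :=
    mem_range_lTensor_iff_piTensorHom.2 fun i => by simpa using hw_mem i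
  rw [← hw, ← map_smul, ← map_smul, ← hv, ← LinearMap.lTensor_comp_apply, hfg,
    LinearMap.lTensor_zero, LinearMap.zero_apply]

theorem IsAlmostFG.of_finite [Module.Finite R N] : IsAlmostFG 𝔪 N := by
  obtain ⟨n, f, hf⟩ := Module.Finite.exists_fin' R N
  exact fun s _ => ⟨n, f, fun x => hf (s • x)⟩

theorem IsAlmostCoherentRing.isAlmostFlat_pi (h𝔪 : 𝔪 ^ 2 = 𝔪) (hR : IsAlmostCoherentRing 𝔪)
    {ι : Type u} {F : ι → Type u} [∀ i, AddCommGroup (F i)] [∀ i, Module R (F i)]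
    (hF : ∀ i, IsAlmostFlat 𝔪 (F i)) : IsAlmostFlat 𝔪 (∀ i, F i) := by
  refine .of_forall_fg_ideal h𝔪 fun I hI => isAlmostInjective_iff.2 fun z hz => ?_
  refine smul_eq_zero_of_forall_smul_smul_eq_zero h𝔪 fun s hs t ht => ?_
  have := Module.Finite.iff_fg.2 hI
  have hI_fp : IsAlmostFP 𝔪 I := hR.2 I I.subtype (.of_injective I.injective_subtype) .of_finite
  refine isAlmostInjective_iff.1 (hI_fp.isAlmostInjective_piTensorHom h𝔪 hF) _ ?_ s hs
  ext i
  rw [map_smul, Pi.smul_apply, Pi.zero_apply]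
  refine isAlmostInjective_iff.1 ((hF i).isAlmostInjective_lTensor I.injective_subtype) _ ?_ t ht
  rw [← piTensorHom_lTensor, hz, map_zero, Pi.zero_apply]

theorem isAlmostFG_iff_exists_fg :
    IsAlmostFG 𝔪 N ↔ ∀ s ∈ 𝔪, ∃ L : Submodule R N, L.FG ∧ ∀ x, s • x ∈ L := by
  refine forall₂_congr fun s _ => ⟨?_, ?_⟩
  · rintro ⟨n, f, hf⟩
    exact ⟨f.range, (Submodule.fg_iff_exists_fin_linearMap R N).2 ⟨n, f, rfl⟩, hf⟩
  · rintro ⟨L, hL, hs⟩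
    obtain ⟨n, f, rfl⟩ := (Submodule.fg_iff_exists_fin_linearMap R N).1 hL
    exact ⟨n, f, hs⟩

theorem IsAlmostFG.of_forall_mul (h𝔪 : 𝔪 ^ 2 = 𝔪)
    (h : ∀ s ∈ 𝔪, ∀ t ∈ 𝔪, ∃ L : Submodule R N, L.FG ∧ ∀ x, (s * t) • x ∈ L) :
    IsAlmostFG 𝔪 N := by
  refine isAlmostFG_iff_exists_fg.2 fun s hs => ?_
  rw [← h𝔪, pow_two] at hs
  induction hs using Submodule.mul_induction_on' with
  | mem_mul_mem a ha b hb => exact h a ha b hb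
  | add a _ b _ ha hb =>
    obtain ⟨L, hL, ha⟩ := ha
    obtain ⟨L', hL', hb⟩ := hb
    refine ⟨L ⊔ L', hL.sup hL', fun x => ?_⟩
    rw [add_smul]
    exact Submodule.add_mem_sup (ha x) (hb x)

theorem IsAlmostFG.of_injective_of_smul_mem_range (h𝔪 : 𝔪 ^ 2 = 𝔪) {N' : Type u}
    [AddCommGroup N'] [Module R N'] (hN' : IsAlmostFG 𝔪 N') {j : N →ₗ[R] N'}
    (hj : Function.Injective j)
    (h : ∀ s ∈ 𝔪, ∀ y, s • y ∈ LinearMap.range j) : IsAlmostFG 𝔪 N := by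
  refine .of_forall_mul h𝔪 fun a ha b hb => ?_
  obtain ⟨L, hL, hbL⟩ := isAlmostFG_iff_exists_fg.1 hN' b hb
  let aL := L.map (LinearMap.lsmul R N' a)
  have haL : aL ≤ LinearMap.range j := by
    rintro _ ⟨y, _, rfl⟩
    exact h a ha y
  refine ⟨aL.comap j, Submodule.fg_of_fg_map_injective j hj ?_, fun x => ?_⟩
  · rw [Submodule.map_comap_eq_of_le haL]
    exact hL.map _
  · exact ⟨b • j x, hbL (j x), by simp [mul_smul, smul_comm a b]⟩

theorem isAlmostFG_ker_of_isAlmostFlat_pi {X Y : Type u} [AddCommGroup X] [Module R X]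
    [Module.Free R X] [Module.Finite R X] [AddCommGroup Y] [Module R Y] [Module.Free R Y]
    [Module.Finite R Y] (q : X →ₗ[R] Y) (h : IsAlmostFlat 𝔪 (q.ker → R)) :
    IsAlmostFG 𝔪 q.ker := by
  refine isAlmostFG_iff_exists_fg.2 fun s hs => ?_
  obtain ⟨w, hw⟩ := (piTensorHom_bijective R (fun _ : q.ker => R) X).surjective
    fun k => 1 ⊗ₜ (k : X)
  have hqw : q.lTensor (q.ker → R) w = 0 := by
    refine lTensor_eq_zero_iff_piTensorHom.2 fun k => ?_
    rw [hw, LinearMap.lTensor_tmul, k.2, TensorProduct.tmul_zero]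
  obtain ⟨y, hy⟩ := h.smul_mem_range_lTensor q.exact_subtype_ker_map hqw hs
  obtain ⟨L, hL, hyL⟩ :=
    TensorProduct.exists_finite_submodule_right_of_setFinite {y} (Set.finite_singleton y)
  obtain ⟨v, rfl⟩ := hyL rfl
  refine ⟨L, Module.Finite.iff_fg.1 hL, fun k => ?_⟩
  let c : L := TensorProduct.lid R L (piTensorHom R _ L v k)
  have hc : s • k = c := by
    have := congrArg (fun z => TensorProduct.lid R X (piTensorHom R _ X z k)) hy
    simp only [piTensorHom_lTensor, map_smul, Pi.smul_apply, hw, TensorProduct.lid_tmul, one_smul,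
      lid_lTensor] at this
    exact Subtype.ext this.symm
  exact hc ▸ c.2

theorem isAlmostCoherentRing_of_isAlmostFlat_pi (h𝔪 : 𝔪 ^ 2 = 𝔪)
    (h : ∀ ι : Type u, IsAlmostFlat 𝔪 (ι → R)) : IsAlmostCoherentRing 𝔪 := by
  refine ⟨.of_finite, fun N _ _ i hi hN s hs t ht => ?_⟩
  obtain ⟨n, f, hf⟩ := hN s hs
  have hker : IsAlmostFG 𝔪 f.ker := by
    have hle : f.ker ≤ (i ∘ₗ f).ker := LinearMap.ker_le_ker_comp f i
    refine (isAlmostFG_ker_of_isAlmostFlat_pi (i ∘ₗ f) (h _)).of_injective_of_smul_mem_range h𝔪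
      (Submodule.inclusion_injective hle) fun a ha y => ?_
    have hay : f (a • (y : Fin n → R)) = 0 := by
      rw [map_smul, isAlmostInjective_iff.1 hi _ y.2 a ha]
    exact ⟨⟨a • y, hay⟩, rfl⟩
  obtain ⟨m, g, hg⟩ := hker t ht
  refine ⟨m, n, f.ker.subtype ∘ₗ g, f, ?_, hf, fun y hy => ?_⟩
  · rw [← LinearMap.comp_assoc, LinearMap.comp_ker_subtype, LinearMap.zero_comp]
  · obtain ⟨x, hx⟩ := hg ⟨y, hy⟩
    exact ⟨x, congrArg Subtype.val hx⟩

end Coherent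

section Pure

variable {R Q : Type*} [CommRing R] [AddCommGroup Q] [Module R Q]

/-- A submodule is pure if every finite linear system over `R` with right-hand side in the
submodule that is solvable in the ambient module is already solvable in the submodule.  This
equational form, rather than injectivity after tensoring, is what closure under solving systems
produces. -/
def IsPureSubmodule (S : Submodule R Q) : Prop :=
  ∀ (m n : ℕ) (A : Fin m → Fin n → R) (b : Fin m → S),
    (∃ y : Fin n → Q, ∀ i, (b i : Q) = ∑ j, A i j • y j) →
      ∃ y : Fin n → S, ∀ i, b i = ∑ j, A i j • y j

theorem IsPureSubmodule.rTensor_injective {S : Submodule R Q} (hS : IsPureSubmodule S)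
    (N : Type*) [AddCommGroup N] [Module R N] [Module.Finite R N] :
    Function.Injective (S.subtype.rTensor N) := by
  refine (injective_iff_map_eq_zero _).2 fun z hz => ?_
  obtain ⟨n, a, ha⟩ := Module.Finite.exists_fin (R := R) (M := N)
  obtain ⟨q, rfl⟩ := exists_sum_tmul_eq_of_span_eq_top S ha z
  have hsum : ∑ i, a i ⊗ₜ[R] (q i : Q) = 0 := by
    simpa using congrArg (TensorProduct.comm R Q N) hz
  obtain ⟨k, A, y, hqy, hA⟩ := TensorProduct.vanishesTrivially_of_sum_tmul_eq_zero R ha hsum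
  obtain ⟨y', hqy'⟩ := hS n k A q ⟨y, hqy⟩
  have hsum' : ∑ i, a i ⊗ₜ[R] q i = 0 :=
    TensorProduct.sum_tmul_eq_zero_of_vanishesTrivially R ⟨k, A, y', hqy', hA⟩
  simpa using congrArg (TensorProduct.comm R N S) hsum'

end Pure

/-- Formal terms generated by `M` under the module operations and under solving finite linear
systems over `R`.  They name the elements of a pure submodule containing the image of `M`, and
bound its size by a set that depends only on `R` and `M`. -/
inductive SolutionTerm (R M : Type u) : Type u
  | of (x : M) : SolutionTerm R M
  | zero : SolutionTerm R M
  | add (a b : SolutionTerm R M) : SolutionTerm R M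
  | smul (r : R) (a : SolutionTerm R M) : SolutionTerm R M
  | solve (m n : ℕ) (A : Fin m → Fin n → R) (b : Fin m → SolutionTerm R M) (j : Fin n) :
      SolutionTerm R M

namespace SolutionTerm

variable {R M : Type u} {Q : Type*} [CommRing R] [AddCommGroup M] [Module R M]
  [AddCommGroup Q] [Module R Q]

open Classical in
/-- The element of `Q` named by a term, for a map `φ : M → Q`.  The term `solve m n A b j` names the
`j`-th coordinate of a chosen solution of `A y = b`, and `0` if there is none. -/
noncomputable def eval (φ : M →ₗ[R] Q) : SolutionTerm R M → Q
  | of x => φ x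
  | zero => 0
  | add a b => eval φ a + eval φ b
  | smul r a => r • eval φ a
  | solve _ n A b j =>
    if h : ∃ y : Fin n → Q, ∀ i, eval φ (b i) = ∑ j, A i j • y j then h.choose j else 0

/-- The submodule of the elements of `Q` named by terms: a pure submodule containing the image of
`φ`. -/
def closure (φ : M →ₗ[R] Q) : Submodule R Q where
  carrier := Set.range (eval φ)
  zero_mem' := ⟨zero, rfl⟩
  add_mem' := by
    rintro _ _ ⟨a, rfl⟩ ⟨b, rfl⟩
    exact ⟨add a b, rfl⟩
  smul_mem' := by
    rintro r _ ⟨a, rfl⟩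
    exact ⟨smul r a, rfl⟩

theorem isPureSubmodule_closure (φ : M →ₗ[R] Q) : IsPureSubmodule (closure φ) := by
  intro m n A b h
  choose t ht using fun i => (b i).2
  simp only [← ht] at h
  have heval (j : Fin n) : eval φ (solve m n A t j) = h.choose j := by
    rw [eval, dif_pos h]
  refine ⟨fun j => ⟨h.choose j, _, heval j⟩, fun i => Subtype.ext ?_⟩
  simpa [ht] using h.choose_spec i

theorem exists_linearMap_surjective_closure (φ : M →ₗ[R] Q) :
    ∃ p : (SolutionTerm R M →₀ R) →ₗ[R] closure φ, Function.Surjective p := by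
  refine ⟨Finsupp.linearCombination R fun t => ⟨eval φ t, t, rfl⟩, ?_⟩
  rintro ⟨_, t, rfl⟩
  exact ⟨Finsupp.single t 1, by simp⟩

end SolutionTerm

section Preenvelope

variable {R : Type u} [CommRing R] {𝔪 : Ideal R} {M : Type u} [AddCommGroup M] [Module R M]

theorem isAlmostFlatPreenvelope_pi {ι : Type u} {F : ι → Type u} [∀ i, AddCommGroup (F i)]
    [∀ i, Module R (F i)] {a : ∀ i, M →ₗ[R] F i} (hF : IsAlmostFlat 𝔪 (∀ i, F i))
    (ha : ∀ (Q : Type u) [AddCommGroup Q] [Module R Q], IsAlmostFlat 𝔪 Q → ∀ φ : M →ₗ[R] Q,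
      ∃ (i : ι) (b : F i →ₗ[R] Q), b ∘ₗ a i = φ) :
    IsAlmostFlatPreenvelope 𝔪 (LinearMap.pi a) := by
  refine ⟨hF, fun Q _ _ hQ φ => ?_⟩
  obtain ⟨i, b, rfl⟩ := ha Q hQ φ
  exact ⟨b ∘ₗ LinearMap.proj i, rfl⟩

theorem exists_isAlmostFlatPreenvelope_of_quotients
    (h : ∀ (ι : Type u) (F : ι → Type u) [∀ i, AddCommGroup (F i)] [∀ i, Module R (F i)],
        (∀ i, IsAlmostFlat 𝔪 (F i)) → IsAlmostFlat 𝔪 (∀ i, F i))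
    (X : Type u) [AddCommGroup X] [Module R X]
    (hX : ∀ (Q : Type u) [AddCommGroup Q] [Module R Q], IsAlmostFlat 𝔪 Q → ∀ φ : M →ₗ[R] Q,
      ∃ (K : Submodule R X) (a : M →ₗ[R] X ⧸ K) (b : (X ⧸ K) →ₗ[R] Q),
        IsAlmostFlat 𝔪 (X ⧸ K) ∧ b ∘ₗ a = φ) :
    ∃ (P : Type u) (_ : AddCommGroup P) (_ : Module R P) (f : M →ₗ[R] P),
      IsAlmostFlatPreenvelope 𝔪 f := by
  let ι := Σ K : {K : Submodule R X // IsAlmostFlat 𝔪 (X ⧸ K)}, M →ₗ[R] X ⧸ K.1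
  refine ⟨∀ i : ι, X ⧸ i.1.1, inferInstance, inferInstance, LinearMap.pi fun i => i.2,
    isAlmostFlatPreenvelope_pi (h ι (fun i => X ⧸ i.1.1) fun i => i.1.2) fun Q _ _ hQ φ => ?_⟩
  obtain ⟨K, a, b, hK, rfl⟩ := hX Q hQ φ
  exact ⟨⟨⟨K, hK⟩, a⟩, b, rfl⟩

open SolutionTerm in
theorem IsAlmostFlat.exists_factorization_through_quotient (h𝔪 : 𝔪 ^ 2 = 𝔪) {Q : Type u}
    [AddCommGroup Q] [Module R Q] (hQ : IsAlmostFlat 𝔪 Q) (φ : M →ₗ[R] Q) :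
    ∃ (K : Submodule R (SolutionTerm R M →₀ R)) (a : M →ₗ[R] (SolutionTerm R M →₀ R) ⧸ K)
      (b : ((SolutionTerm R M →₀ R) ⧸ K) →ₗ[R] Q),
      IsAlmostFlat 𝔪 ((SolutionTerm R M →₀ R) ⧸ K) ∧ b ∘ₗ a = φ := by
  obtain ⟨p, hp⟩ := exists_linearMap_surjective_closure φ
  let e := p.quotKerEquivOfSurjective hp
  let φ' : M →ₗ[R] closure φ := φ.codRestrict _ fun x => ⟨of x, rfl⟩
  have hclosure : IsAlmostFlat 𝔪 (closure φ) :=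
    hQ.of_rTensor_injective h𝔪 (closure φ).subtype fun I hI =>
      have := Module.Finite.iff_fg.2 hI
      (isPureSubmodule_closure φ).rTensor_injective I
  refine ⟨p.ker, e.symm.toLinearMap ∘ₗ φ', (closure φ).subtype ∘ₗ e.toLinearMap,
    hclosure.of_retract e.toLinearMap e.symm.toLinearMap (LinearMap.ext e.symm_apply_apply), ?_⟩
  ext x
  exact congrArg Subtype.val (e.apply_symm_apply (φ' x))

theorem isAlmostFlat_pi_of_exists_isAlmostFlatPreenvelope {ι : Type u} {F : ι → Type u}
    [∀ i, AddCommGroup (F i)] [∀ i, Module R (F i)]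
    (h : ∃ (P : Type u) (_ : AddCommGroup P) (_ : Module R P) (f : (∀ i, F i) →ₗ[R] P),
      IsAlmostFlatPreenvelope 𝔪 f)
    (hF : ∀ i, IsAlmostFlat 𝔪 (F i)) : IsAlmostFlat 𝔪 (∀ i, F i) := by
  obtain ⟨P, _, _, f, hP, hf⟩ := h
  choose r hr using fun i => hf (F i) (hF i) (LinearMap.proj i)
  refine hP.of_retract f (LinearMap.pi r) ?_
  exact LinearMap.ext fun x => funext fun i => LinearMap.congr_fun (hr i) x

end Preenvelope

theorem mainTheorem1 (R : Type u) [CommRing R] (𝔪 : Ideal R) (h𝔪 : 𝔪 ^ 2 = 𝔪) :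
    List.TFAE [
      IsAlmostCoherentRing 𝔪,
      ∀ (ι : Type u) (F : ι → Type u) [∀ i, AddCommGroup (F i)] [∀ i, Module R (F i)],
        (∀ i, IsAlmostFlat 𝔪 (F i)) → IsAlmostFlat 𝔪 (∀ i, F i),
      ∀ (ι : Type u) (F : ι → Type u) [∀ i, AddCommGroup (F i)] [∀ i, Module R (F i)],
        (∀ i, Module.Flat R (F i)) → IsAlmostFlat 𝔪 (∀ i, F i),
      ∀ (ι : Type u) (F : ι → Type u) [∀ i, AddCommGroup (F i)] [∀ i, Module R (F i)],
        (∀ i, Module.Projective R (F i)) → IsAlmostFlat 𝔪 (∀ i, F i),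
      ∀ ι : Type u, IsAlmostFlat 𝔪 (ι → R),
      ∀ (M : Type u) [AddCommGroup M] [Module R M],
        ∃ (P : Type u) (_ : AddCommGroup P) (_ : Module R P) (f : M →ₗ[R] P),
          IsAlmostFlatPreenvelope 𝔪 f] := by
  tfae_have 1 → 2 := fun h ι F _ _ hF => h.isAlmostFlat_pi h𝔪 hF
  tfae_have 2 → 3 := fun h ι F _ _ hF => h ι F fun i => .of_flat
  tfae_have 3 → 4 := fun h ι F _ _ hF => h ι F fun i => inferInstance
  tfae_have 4 → 5 := fun h ι => h ι (fun _ => R) fun _ => inferInstance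
  tfae_have 5 → 1 := isAlmostCoherentRing_of_isAlmostFlat_pi h𝔪
  tfae_have 2 → 6 := fun h M _ _ => exists_isAlmostFlatPreenvelope_of_quotients h _
    fun Q _ _ hQ φ => hQ.exists_factorization_through_quotient h𝔪 φ
  tfae_have 6 → 2 := fun h ι F _ _ hF =>
    isAlmostFlat_pi_of_exists_isAlmostFlatPreenvelope (h (∀ i, F i)) hF
  tfae_finish
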